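/- Let $m,n$ be natural numbers. A state on $\mathcal B(\mathbb C^m\otimes\mathbb C^n)=\mathcal B(\mathbb C^m)\otimes\mathcal B(\mathbb C^n)$ is separable if it is a convex combination of product states $\omega_1\otimes\omega_2$, where $\omega_1$ is a state on $\mathcal B(\mathbb C^m)$, $\omega_2$ is a state on $\mathcal B(\mathbb C^n)$, and $(\omega_1\otimes\omega_2)(A\otimes B)=\omega_1(A)\,\omega_2(B)$. Let $S$ be the convex set of separable states. Let $(\Phi_t)_{t\in\mathbb R}$ be a one-parameter group of affine automorphisms of $S$: each $\Phi_t:S\to S$ is a bijection preserving convex combinations, $\Phi_0=\mathrm{id}$, $\Phi_{s+t}=\Phi_s\circ\Phi_t$ for all $s,t\in\mathbb R$, and $t\mapsto\Phi_t(\omega)(A)$ is continuous for every $\omega\in S$ and every $A\in\mathcal B(\mathbb C^m\otimes\mathbb C^n)$. Then there are one-parameter groups of unitaries $(U_t)_{t\in\mathbb R}$ in $\mathcal B(\mathbb C^m)$ and $(V_t)_{t\in\mathbb R}$ in $\mathcal B(\mathbb C^n)$ (that is, continuous homomorphisms from $(\mathbb R,+)$ to the unitary groups) such that $$\Phi_t(\omega)(A)=\omega\big((U_t\otimes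 V_t)\,A\,(U_t\otimes V_t)^*\big)$$ for all $t\in\mathbb R$, all $\omega\in S$ and all $A\in\mathcal B(\mathbb C^m\otimes\mathbb C^n)$. -/

import Mathlib

open scoped Kronecker ComplexOrder Matrix

namespace SeparableStates

/-- The state space of `B(ℂ^ι)`, operators being written as `ι × ι` complex matrices: the linear
functionals `ω` with `ω(1) = 1` and `ω(A) ≥ 0` (real and nonnegative) for all positive
semidefinite `A`. -/
def stateSpace (ι : Type*) [Fintype ι] [DecidableEq ι] : Set (Matrix ι ι ℂ →ₗ[ℂ] ℂ) :=
  {ω | ω 1 = 1 ∧ ∀ A : Matrix ι ι ℂ, A.PosSemidef → 0 ≤ ω A}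

/-- The product states on `B(ℂ^m ⊗ ℂ^n) = B(ℂ^m) ⊗ B(ℂ^n)`: the states `τ` for which there are
states `ω`, `σ` of the factors with `τ(A ⊗ B) = ω(A) σ(B)`. The tensor product of matrices is the
Kronecker product. -/
def productStates (m n : ℕ) : Set (Matrix (Fin m × Fin n) (Fin m × Fin n) ℂ →ₗ[ℂ] ℂ) :=
  {τ | τ ∈ stateSpace (Fin m × Fin n) ∧
    ∃ ω ∈ stateSpace (Fin m), ∃ σ ∈ stateSpace (Fin n),
      ∀ (A : Matrix (Fin m) (Fin m) ℂ) (B : Matrix (Fin n) (Fin n) ℂ),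
        τ (A ⊗ₖ B) = ω A * σ B}

/-- The set `S` of separable states on `B(ℂ^m ⊗ ℂ^n)`: the convex combinations of product
states. -/
def separableStates (m n : ℕ) : Set (Matrix (Fin m × Fin n) (Fin m × Fin n) ℂ →ₗ[ℂ] ℂ) :=
  convexHull ℝ (productStates m n)

/-- `f` is an affine automorphism of the convex set `C`: a bijection of `C` onto itself that
preserves convex combinations. -/
def IsAffineAutomorphism {E : Type*} [AddCommGroup E] [Module ℝ E] (C : Set E) (f : C → C) :
    Prop :=
  Function.Bijective f ∧
    ∀ (x y z : C) (a b : ℝ), 0 ≤ a → 0 ≤ b → a + b = 1 →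
      (z : E) = a • (x : E) + b • (y : E) → (f z : E) = a • (f x : E) + b • (f y : E)

/-- `Φ` is a one-parameter group of affine automorphisms of the convex set `C` of functionals on
the matrices of size `ι`. Continuity is pointwise, functionals being given the topology of
pointwise convergence (the only Hausdorff vector space topology on this finite-dimensional
space). -/
structure IsOneParameterAffineGroup {ι : Type*} (C : Set (Matrix ι ι ℂ →ₗ[ℂ] ℂ))
    (Φ : ℝ → C → C) : Prop where
  affine : ∀ t, IsAffineAutomorphism C (Φ t)
  map_zero : ∀ ω, Φ 0 ω = ω
  map_add : ∀ s t ω, Φ (s + t) ω = Φ s (Φ t ω)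
  continuous : ∀ (ω : C) (A : Matrix ι ι ℂ),
    Continuous fun t : ℝ => (Φ t ω : Matrix ι ι ℂ →ₗ[ℂ] ℂ) A

/-- `U` is a one-parameter group of unitaries in `B(ℂ^ι)`. -/
structure IsOneParameterUnitaryGroup {ι : Type*} [Fintype ι] [DecidableEq ι]
    (U : ℝ → Matrix.unitaryGroup ι ℂ) : Prop where
  map_zero : U 0 = 1
  map_add : ∀ s t, U (s + t) = U s * U t
  continuous : Continuous U

end SeparableStates

/-! Separable states span all functionals, so each `Φ t` extends linearly and dualises to a map `T
t` of the observables; continuity and the group law give a generator `L`. If `A` is block-positive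
(nonnegative on product vectors) and a product state `ω` kills `A`, then `t ↦ ω (T t A)` has its
minimum `0` at `t = 0`, so `ω (L A) = 0`.

Taking `A = ψψ*` with `ψ ⊥ x ⊗ y` and polarising shows that `L` is a left plus a right
multiplication, `L X = G X + X G'` (`eq_mul_add_mul_of_annihilates`). Partial transposes of the
`ψψ*` are block-positive too, so the conjugate of `L` by partial transposition has the same form.
Comparing both forms on matrix units makes `G` local, `k ⊗ 1 + 1 ⊗ l`. Since `L 1 = 0` and `L`
commutes with adjoints, `L` is the commutator with a skew-Hermitian `a ⊗ 1 + 1 ⊗ b`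
(`exists_eq_local_commutator`), and exponentiating gives the unitaries. -/

namespace SeparableStates

open Matrix

/-! ### Polarisation -/

/-- If `P` is holomorphic along complex lines and `P (star x) x = 0` for all `x`, then `P = 0`. -/
theorem eq_zero_of_star_diagonal {E : Type*} [NormedAddCommGroup E] [NormedSpace ℂ E]
    [StarAddMonoid E] [StarModule ℂ E] (P : E → E → ℂ)
    (hP : ∀ a b c d : E, Differentiable ℂ fun s : ℂ => P (a + s • b) (c + s • d))
    (h : ∀ x, P (star x) x = 0) (p q : E) : P p q = 0 := by
  -- Write `p = u - iv` and `q = u + iv`; here `p = star q` exactly when `u` and `v` are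
  -- self-adjoint.
  obtain ⟨u, hu⟩ : ∃ u : E, u = (2⁻¹ : ℂ) • (p + q) := ⟨_, rfl⟩
  obtain ⟨v, hv⟩ : ∃ v : E, v = (2⁻¹ : ℂ) • (-Complex.I) • (q - p) := ⟨_, rfl⟩
  have hIv : Complex.I • v = (2⁻¹ : ℂ) • (q - p) := by
    rw [hv, smul_comm, smul_smul Complex.I]; simp
  have hq : q = u + Complex.I • v := by
    rw [hIv, hu, ← smul_add]; rw [show p + q + (q - p) = (2 : ℂ) • q by rw [two_smul]; abel]
    simp
  have hp : p = u - Complex.I • v := by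
    rw [hIv, hu, ← smul_sub]; rw [show p + q - (q - p) = (2 : ℂ) • p by rw [two_smul]; abel]
    simp
  let u₁ : E := realPart u
  let u₂ : E := imaginaryPart u
  let v₁ : E := realPart v
  let v₂ : E := imaginaryPart v
  have su₁ : star u₁ = u₁ := (realPart u).2
  have su₂ : star u₂ = u₂ := (imaginaryPart u).2
  have sv₁ : star v₁ = v₁ := (realPart v).2
  have sv₂ : star v₂ = v₂ := (imaginaryPart v).2
  have eu : u₁ + Complex.I • u₂ = u := realPart_add_I_smul_imaginaryPart u
  have ev : v₁ + Complex.I • v₂ = v := realPart_add_I_smul_imaginaryPart v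
  -- The `i` in `u₁ + i u₂` and `v₁ + i v₂` becomes a variable `s`. For real `s` the two arguments
  -- are adjoint to each other, so `g` vanishes on `ℝ`, hence everywhere; `s = i` recovers `(p, q)`.
  let g : ℂ → ℂ := fun s =>
    P ((u₁ - Complex.I • v₁) + s • (u₂ - Complex.I • v₂))
      ((u₁ + Complex.I • v₁) + s • (u₂ + Complex.I • v₂))
  have hg : Differentiable ℂ g := hP _ _ _ _
  have hreal : ∀ s : ℝ, g s = 0 := by
    intro s
    have := h ((u₁ + Complex.I • v₁) + (s : ℂ) • (u₂ + Complex.I • v₂))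
    rw [← this]
    simp only [g]
    congr 1
    simp [star_add, star_smul, su₁, su₂, sv₁, sv₂, sub_eq_add_neg]
  have hfreq : ∃ᶠ z in nhdsWithin (0 : ℂ) {0}ᶜ, g z = (fun _ => (0 : ℂ)) z := by
    have ht : Filter.Tendsto (fun n : ℕ => (((1 : ℝ) / ((n : ℝ) + 1) : ℝ) : ℂ)) Filter.atTop
        (nhdsWithin (0 : ℂ) {0}ᶜ) := by
      refine tendsto_nhdsWithin_iff.2 ⟨?_, Filter.Eventually.of_forall fun n => ?_⟩
      · have := (Complex.continuous_ofReal.tendsto 0).comp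
          (tendsto_one_div_add_atTop_nhds_zero_nat (𝕜 := ℝ))
        simpa [Function.comp_def] using this
      · simp only [Set.mem_compl_iff, Set.mem_singleton_iff, Complex.ofReal_eq_zero]
        positivity
    exact ht.frequently (Filter.Frequently.of_forall fun n => hreal _)
  have han : AnalyticOnNhd ℂ g Set.univ := fun z _ =>
    (hg.differentiableOn (s := Set.univ)).analyticAt Filter.univ_mem
  have hzero := AnalyticOnNhd.eq_of_frequently_eq han analyticOnNhd_const hfreq
  have hI := congrFun hzero Complex.I
  simp only [g] at hI
  convert hI using 2
  · rw [hp, ← eu, ← ev]; module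
  · rw [hq, ← eu, ← ev]; module

/-! ### Linear maps constrained on product vectors -/

section Tensor

variable {α β : Type*} [Fintype α] [Fintype β] [DecidableEq α] [DecidableEq β]

/-- The tensor product of two vectors. -/
def kronVec (x : α → ℂ) (y : β → ℂ) : α × β → ℂ := fun i => x i.1 * y i.2

omit [Fintype α] [Fintype β] in
theorem kronVec_single (a : α) (b : β) :
    kronVec (Pi.single a 1) (Pi.single b 1) = Pi.single (a, b) 1 := by
  ext ⟨c, d⟩
  by_cases h : c = a <;> by_cases h' : d = b <;> simp [kronVec, h, h']

omit [Fintype α] [Fintype β] [DecidableEq α] [DecidableEq β] in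
theorem kronVec_add_left (x x' : α → ℂ) (y : β → ℂ) :
    kronVec (x + x') y = kronVec x y + kronVec x' y := by
  ext; simp [kronVec, add_mul]

omit [Fintype α] [Fintype β] [DecidableEq α] [DecidableEq β] in
theorem kronVec_add_right (x : α → ℂ) (y y' : β → ℂ) :
    kronVec x (y + y') = kronVec x y + kronVec x y' := by
  ext; simp [kronVec, mul_add]

omit [Fintype α] [Fintype β] [DecidableEq α] [DecidableEq β] in
theorem star_kronVec (x : α → ℂ) (y : β → ℂ) :
    star (kronVec x y) = kronVec (star x) (star y) := by
  ext; simp [kronVec]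

/-- A bilinear form which vanishes on `(p ⊗ r, Z)` whenever the pairing of `p ⊗ r` and `Z` is zero
is a multiple of the pairing. -/
theorem scalar_of_annihilates (N : Matrix (α × β) (α × β) ℂ)
    (h : ∀ p r Z, kronVec p r ⬝ᵥ Z = 0 → kronVec p r ⬝ᵥ N *ᵥ Z = 0) (o i j : α × β) :
    N i j = if i = j then N o o else 0 := by
  have hoff : ∀ i j, i ≠ j → N i j = 0 := by
    intro i j hij
    have := h (Pi.single i.1 1) (Pi.single i.2 1) (Pi.single j 1)
    rw [kronVec_single] at this
    simpa [hij] using this (by simp [hij])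
  have hpair : ∀ i j : α × β, i ≠ j → (Pi.single i 1 + Pi.single j 1 : α × β → ℂ) ⬝ᵥ
      (Pi.single i 1 - Pi.single j 1) = 0 := by
    intro i j hij
    simp [hij, hij.symm, dotProduct_sub]
  have hdiag : ∀ i j : α × β, i ≠ j → (Pi.single i 1 + Pi.single j 1 : α × β → ℂ) ⬝ᵥ
      N *ᵥ (Pi.single i 1 - Pi.single j 1) = 0 → N i i = N j j := by
    intro i j hij
    simp only [mulVec_sub, dotProduct_sub, add_dotProduct, single_one_dotProduct,
      mulVec_single_one, col_apply, hoff i j hij, hoff j i hij.symm]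
    intro h
    linear_combination h
  -- `e_i + e_j` is a product vector only if `i` and `j` share a coordinate, so diagonal entries are
  -- compared one coordinate at a time.
  have h1 : ∀ a a' b, N (a, b) (a, b) = N (a', b) (a', b) := by
    intro a a' b
    by_cases haa : a = a'
    · rw [haa]
    have hne : (a, b) ≠ (a', b) := by simp [haa]
    refine hdiag _ _ hne ?_
    have := h (Pi.single a 1 + Pi.single a' 1) (Pi.single b 1)
      (Pi.single (a, b) 1 - Pi.single (a', b) 1)
    rw [kronVec_add_left, kronVec_single, kronVec_single] at this
    exact this (hpair _ _ hne)
  have h2 : ∀ a b b', N (a, b) (a, b) = N (a, b') (a, b') := by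
    intro a b b'
    by_cases hbb : b = b'
    · rw [hbb]
    have hne : (a, b) ≠ (a, b') := by simp [hbb]
    refine hdiag _ _ hne ?_
    have := h (Pi.single a 1) (Pi.single b 1 + Pi.single b' 1)
      (Pi.single (a, b) 1 - Pi.single (a, b') 1)
    rw [kronVec_add_right, kronVec_single, kronVec_single] at this
    exact this (hpair _ _ hne)
  split_ifs with hij
  · subst hij
    rw [show N i i = N (i.1, i.2) (i.1, i.2) from rfl, h1 i.1 o.1, h2 o.1 i.2 o.2]
  · exact hoff i j hij

/-- If the compression of `L (Z Wᵀ)` to product vectors vanishes as soon as `Z` and `W` annihilate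
these vectors, then `L` is the sum of a left and a right multiplication. -/
theorem eq_mul_add_mul_of_annihilates
    (L : Matrix (α × β) (α × β) ℂ →ₗ[ℂ] Matrix (α × β) (α × β) ℂ)
    (h : ∀ p r q s Z W, kronVec p r ⬝ᵥ Z = 0 → kronVec q s ⬝ᵥ W = 0 →
      kronVec p r ⬝ᵥ L (vecMulVec Z W) *ᵥ kronVec q s = 0) (o : α × β) :
    ∃ G G' : Matrix (α × β) (α × β) ℂ, ∀ X, L X = G * X + X * G' := by
  have step : ∀ q s W, kronVec q s ⬝ᵥ W = 0 → ∀ i j,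
      (L (vecMulVec (Pi.single j 1) W) *ᵥ kronVec q s) i =
        if i = j then (L (vecMulVec (Pi.single o 1) W) *ᵥ kronVec q s) o else 0 := by
    intro q s W hW i j
    let T : (α × β → ℂ) →ₗ[ℂ] (α × β → ℂ) :=
      { toFun := fun Z => L (vecMulVec Z W) *ᵥ kronVec q s
        map_add' := fun Z Z' => by rw [add_vecMulVec, map_add, add_mulVec]
        map_smul' := fun c Z => by rw [smul_vecMulVec, map_smul, smul_mulVec, RingHom.id_apply] }
    have := scalar_of_annihilates (LinearMap.toMatrix' T) (fun p r Z hZ => by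
      rw [LinearMap.toMatrix'_mulVec]
      exact h p r q s Z W hZ hW) o i j
    simpa [LinearMap.toMatrix'_apply, T] using this
  -- By `step`, the row functional left after removing the `δ_ij` part again annihilates every `W`
  -- paired to zero with a product vector, so `scalar_of_annihilates` applies a second time, now in
  -- `W`.
  have key : ∀ i j k l, L (Matrix.single j k 1) i l -
      (if i = j then L (Matrix.single o k 1) o l else 0) =
        if l = k then L (Matrix.single j o 1) i o -
          (if i = j then L (Matrix.single o o 1) o o else 0) else 0 := by
    intro i j k l
    let T : (α × β → ℂ) →ₗ[ℂ] (α × β → ℂ) :=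
      { toFun := fun W => L (vecMulVec (Pi.single j 1) W) i -
          if i = j then L (vecMulVec (Pi.single o 1) W) o else 0
        map_add' := fun W W' => by
          simp only [vecMulVec_add, map_add]
          ext l
          split_ifs <;> simp
          ring
        map_smul' := fun c W => by
          ext l
          simp only [vecMulVec_smul, map_smul]
          split_ifs <;> simp [mul_sub] }
    have := scalar_of_annihilates (LinearMap.toMatrix' T) (fun q s W hW => by
      rw [LinearMap.toMatrix'_mulVec, dotProduct_comm]
      have := step q s W hW i j
      simp only [T, LinearMap.coe_mk, AddHom.coe_mk, sub_dotProduct]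
      simp only [mulVec] at this
      rw [this]
      split_ifs <;> simp) o l k
    have hs : ∀ j k : α × β, vecMulVec (Pi.single j 1 : α × β → ℂ) (Pi.single k 1) =
        Matrix.single j k (1 : ℂ) := fun j k => by
      rw [single_eq_single_vecMulVec_single]
    simp only [LinearMap.toMatrix'_apply, T, LinearMap.coe_mk, AddHom.coe_mk] at this
    by_cases hij : i = j
    · simpa [hij, hs] using this
    · simpa [hij, hs] using this
  obtain ⟨G, hG⟩ : ∃ G : Matrix (α × β) (α × β) ℂ, ∀ i j, L (Matrix.single j o 1) i o = G i j :=
    ⟨Matrix.of fun i j => L (Matrix.single j o 1) i o, fun _ _ => rfl⟩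
  -- The `(o, o)` term is already contained in `G`, so it is removed from `G'`.
  obtain ⟨G', hG'⟩ : ∃ G' : Matrix (α × β) (α × β) ℂ, ∀ k l, L (Matrix.single o k 1) o l -
      (if l = k then L (Matrix.single o o 1) o o else 0) = G' k l :=
    ⟨Matrix.of fun k l => L (Matrix.single o k 1) o l -
      if l = k then L (Matrix.single o o 1) o o else 0, fun _ _ => rfl⟩
  refine ⟨G, G', fun X => ?_⟩
  have hL : ∀ j k i l, L (Matrix.single j k 1) i l =
      (if l = k then G i j else 0) + (if i = j then G' k l else 0) := by
    intro j k i l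
    have := key i j k l
    rw [← hG, ← hG']
    split_ifs at this ⊢ <;> linear_combination this
  ext i l
  conv_lhs => rw [matrix_eq_sum_single X]
  have hX : ∀ j k, Matrix.single j k (X j k) = X j k • Matrix.single j k (1 : ℂ) := by
    simp [smul_single]
  simp only [hX, map_sum, map_smul, Matrix.sum_apply, Matrix.smul_apply, hL, smul_eq_mul, mul_add,
    Finset.sum_add_distrib, Matrix.add_apply, Matrix.mul_apply]
  congr 1
  · simp [mul_comm]
  · rw [Finset.sum_comm]
    simp

end Tensor

/-- The positive functional `A ↦ ⟨v, A v⟩`. -/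
def vectorFunctional {ι : Type*} [Fintype ι] (v : ι → ℂ) : Matrix ι ι ℂ →ₗ[ℂ] ℂ where
  toFun A := star v ⬝ᵥ A *ᵥ v
  map_add' A B := by rw [add_mulVec, dotProduct_add]
  map_smul' c A := by rw [smul_mulVec, dotProduct_smul, RingHom.id_apply]

theorem vectorFunctional_apply {ι : Type*} [Fintype ι] (v : ι → ℂ) (A : Matrix ι ι ℂ) :
    vectorFunctional v A = star v ⬝ᵥ A *ᵥ v := rfl

theorem mul_single_one_apply {ι : Type*} [Fintype ι] [DecidableEq ι] (X : Matrix ι ι ℂ)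
    (j k i l : ι) : (X * Matrix.single j k (1 : ℂ)) i l = if k = l then X i j else 0 := by
  by_cases h : k = l <;> simp [Matrix.mul_apply, Matrix.single_apply, h]

theorem single_one_mul_apply {ι : Type*} [Fintype ι] [DecidableEq ι] (X : Matrix ι ι ℂ)
    (j k i l : ι) : (Matrix.single j k (1 : ℂ) * X) i l = if i = j then X k l else 0 := by
  by_cases h : i = j <;> simp [Matrix.mul_apply, Matrix.single_apply, h, Ne.symm]

/-! ### Tangent generators are local commutators -/

section Local

variable {α β : Type*} [Fintype α] [Fintype β] [DecidableEq α] [DecidableEq β]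

theorem map_apply_eq_sum {ι : Type*} [Fintype ι] [DecidableEq ι]
    (L : Matrix ι ι ℂ →ₗ[ℂ] Matrix ι ι ℂ) (M : Matrix ι ι ℂ) (i l : ι) :
    L M i l = ∑ j, ∑ k, M j k * L (Matrix.single j k 1) i l := by
  conv_lhs => rw [matrix_eq_sum_single M]
  have hM : ∀ j k, Matrix.single j k (M j k) = M j k • Matrix.single j k (1 : ℂ) := by
    simp [smul_single]
  simp only [hM, map_sum, map_smul, Matrix.sum_apply, Matrix.smul_apply, smul_eq_mul]

omit [DecidableEq α] [DecidableEq β] in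
theorem exists_dotProduct_kronVec_ne_zero {p : α → ℂ} {r : β → ℂ} (h : kronVec p r ≠ 0) :
    ∃ e, kronVec p r ⬝ᵥ e ≠ 0 := by
  by_contra! he
  exact h (dotProduct_eq_zero _ he)

/-- Polarisation needs a parametrisation without constraints: for `k = x ⊗ y`, the vector `⟨k,e⟩ψ -
⟨k,ψ⟩e` is orthogonal to `k` for arbitrary `ψ` and `e`. The resulting expression is polynomial in
the variables and their conjugates, which may then be made independent. -/
theorem annihilates_of_orthogonal
    (L : Matrix (α × β) (α × β) ℂ →ₗ[ℂ] Matrix (α × β) (α × β) ℂ)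
    (h : ∀ x y ψ, star (kronVec x y) ⬝ᵥ ψ = 0 →
      vectorFunctional (kronVec x y) (L (vecMulVec ψ (star ψ))) = 0)
    (p : α → ℂ) (r : β → ℂ) (q : α → ℂ) (s : β → ℂ) (Z W : α × β → ℂ)
    (hZ : kronVec p r ⬝ᵥ Z = 0) (hW : kronVec q s ⬝ᵥ W = 0) :
    kronVec p r ⬝ᵥ L (vecMulVec Z W) *ᵥ kronVec q s = 0 := by
  let P : (α → ℂ) × (β → ℂ) × (α × β → ℂ) × (α × β → ℂ) →
      (α → ℂ) × (β → ℂ) × (α × β → ℂ) × (α × β → ℂ) → ℂ := fun a b =>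
    kronVec a.1 a.2.1 ⬝ᵥ L (vecMulVec
      ((kronVec a.1 a.2.1 ⬝ᵥ b.2.2.2) • b.2.2.1 - (kronVec a.1 a.2.1 ⬝ᵥ b.2.2.1) • b.2.2.2)
      ((kronVec b.1 b.2.1 ⬝ᵥ a.2.2.2) • a.2.2.1 - (kronVec b.1 b.2.1 ⬝ᵥ a.2.2.1) • a.2.2.2)) *ᵥ
      kronVec b.1 b.2.1
  have hP : ∀ a b, P a b = 0 := by
    intro a b
    refine eq_zero_of_star_diagonal P ?_ ?_ a b
    · intro a b c d
      simp only [P, dotProduct, mulVec, map_apply_eq_sum L (vecMulVec _ _), vecMulVec_apply, kronVec,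
        Prod.fst_add, Prod.snd_add, Prod.smul_fst, Prod.smul_snd, Pi.add_apply, Pi.smul_apply,
        Pi.sub_apply, smul_eq_mul]
      fun_prop
    · rintro ⟨x, y, ψ, e⟩
      have := h x y ((star (kronVec x y) ⬝ᵥ e) • ψ - (star (kronVec x y) ⬝ᵥ ψ) • e) (by
        simp only [dotProduct_sub, dotProduct_smul, smul_eq_mul]; ring)
      rw [vectorFunctional_apply] at this
      rw [← this]
      have hc : ∀ v : α × β → ℂ, star (star (kronVec x y) ⬝ᵥ v) = kronVec x y ⬝ᵥ star v := by
        intro v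
        simp [dotProduct]
      simp only [P, Prod.fst_star, Prod.snd_star, star_sub, star_smul, ← star_kronVec, hc]
  by_cases h1 : kronVec p r = 0
  · simp [h1]
  by_cases h2 : kronVec q s = 0
  · simp [h2]
  -- With `Z` and `W` already annihilated, the parametrised vectors are multiples of `Z` and `W`;
  -- `e` and `f` make the factors nonzero.
  obtain ⟨e, he⟩ := exists_dotProduct_kronVec_ne_zero h1
  obtain ⟨f, hf⟩ := exists_dotProduct_kronVec_ne_zero h2
  have := hP (p, r, W, f) (q, s, Z, e)
  simpa [P, hZ, hW, he, hf, smul_vecMulVec, vecMulVec_smul, smul_mulVec] using this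

/-- The partial transposition in the second tensor factor. -/
def partialTranspose : Matrix (α × β) (α × β) ℂ →ₗ[ℂ] Matrix (α × β) (α × β) ℂ where
  toFun X := Matrix.of fun i j => X (i.1, j.2) (j.1, i.2)
  map_add' _ _ := rfl
  map_smul' _ _ := rfl

omit [Fintype α] [Fintype β] [DecidableEq α] [DecidableEq β] in
theorem partialTranspose_apply (X : Matrix (α × β) (α × β) ℂ) (i j : α × β) :
    partialTranspose X i j = X (i.1, j.2) (j.1, i.2) := rfl

omit [DecidableEq α] [DecidableEq β] in
-- This is why partial transposition preserves block-positivity: it only permutes the product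
-- vectors.
theorem vectorFunctional_partialTranspose (x : α → ℂ) (y : β → ℂ) (X : Matrix (α × β) (α × β) ℂ) :
    vectorFunctional (kronVec x y) (partialTranspose X) =
      vectorFunctional (kronVec x (star y)) X := by
  simp only [vectorFunctional_apply, dotProduct, mulVec, Finset.mul_sum, partialTranspose_apply,
    Fintype.sum_prod_type, kronVec, Pi.star_apply, star_mul', star_star]
  refine Finset.sum_congr rfl fun a _ => ?_
  have h3 : ∀ F : β → α → β → ℂ, ∑ b, ∑ a', ∑ b', F b a' b' = ∑ b, ∑ a', ∑ b', F b' a' b := by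
    intro F
    rw [Finset.sum_comm]
    conv_rhs => rw [Finset.sum_comm]
    exact Finset.sum_congr rfl fun a' _ => Finset.sum_comm
  rw [h3]
  refine Finset.sum_congr rfl fun b _ => Finset.sum_congr rfl fun a' _ =>
    Finset.sum_congr rfl fun b' _ => ?_
  ring

/-- A generator which is tangent to the cone of separable functionals is the commutator with a
local operator. -/
theorem exists_eq_local_commutator
    (L : Matrix (α × β) (α × β) ℂ →ₗ[ℂ] Matrix (α × β) (α × β) ℂ)
    (h : ∀ x y ψ, star (kronVec x y) ⬝ᵥ ψ = 0 →
      vectorFunctional (kronVec x y) (L (vecMulVec ψ (star ψ))) = 0)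
    (hΓ : ∀ x y ψ, star (kronVec x (star y)) ⬝ᵥ ψ = 0 →
      vectorFunctional (kronVec x y) (L (partialTranspose (vecMulVec ψ (star ψ)))) = 0)
    (hone : L 1 = 0) (hstar : ∀ X, L Xᴴ = (L X)ᴴ) (o : α × β) :
    ∃ (a : Matrix α α ℂ) (b : Matrix β β ℂ), aᴴ = -a ∧ bᴴ = -b ∧
      ∀ X, L X = (a ⊗ₖ 1 + 1 ⊗ₖ b) * X - X * (a ⊗ₖ 1 + 1 ⊗ₖ b) := by
  obtain ⟨G, G', hG⟩ := eq_mul_add_mul_of_annihilates L (annihilates_of_orthogonal L h) o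
  obtain ⟨K, K', hK⟩ := eq_mul_add_mul_of_annihilates
    (partialTranspose ∘ₗ L ∘ₗ partialTranspose) (annihilates_of_orthogonal _ fun x y ψ hψ => by
      simp only [LinearMap.comp_apply]
      rw [vectorFunctional_partialTranspose]
      exact hΓ x (star y) ψ (by rwa [star_star])) o
  have hG' : G' = -G := by
    have := hG 1
    rw [hone, mul_one, one_mul] at this
    exact (neg_eq_of_add_eq_zero_right this.symm).symm
  have hGloc : ∃ (k : Matrix α α ℂ) (l : Matrix β β ℂ), G = k ⊗ₖ 1 + 1 ⊗ₖ l := by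
    -- Partial transposition sends the unit at `((c, d), o)` to the one at `((c, o.2), (o.1, d))`.
    -- The two forms of `L` there give `G_(ab,cd) + δ_ac δ_bd G'_oo = δ_bd K_(ao,co) + δ_ac
    -- K'_(od,ob)`, which dictates both witnesses.
    refine ⟨Matrix.of fun a c => K (a, o.2) (c, o.2), Matrix.of fun b d => K' (o.1, d) (o.1, b) -
      if b = d then G' o o else 0, ?_⟩
    ext ⟨a, b⟩ ⟨c, d⟩
    have h1 : L (Matrix.single (c, d) o 1) (a, b) o =
        (partialTranspose ∘ₗ L ∘ₗ partialTranspose) (Matrix.single (c, o.2) (o.1, d) 1)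
          (a, o.2) (o.1, b) := by
      simp only [LinearMap.comp_apply, partialTranspose_apply]
      have : partialTranspose (Matrix.single (c, o.2) (o.1, d) 1) =
          Matrix.single (c, d) o (1 : ℂ) := by
        ext i j
        simp only [partialTranspose_apply, Matrix.single_apply, Prod.ext_iff]
        congr 1
        simp only [eq_iff_iff]
        tauto
      rw [this]
    rw [hG, hK] at h1
    simp only [Matrix.add_apply, mul_single_one_apply, single_one_mul_apply, if_true,
      Prod.mk.injEq, true_and, and_true, eq_comm (a := d)] at h1
    simp only [Matrix.add_apply, kroneckerMap_apply, Matrix.of_apply, Matrix.one_apply]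
    by_cases hac : a = c <;> by_cases hbd : b = d <;> simp [hac, hbd] at h1 ⊢ <;>
      linear_combination h1
  obtain ⟨k, l, hkl⟩ := hGloc
  have hL : ∀ X, L X = G * X - X * G := fun X => by rw [hG, hG', mul_neg, sub_eq_add_neg]
  have hL' : ∀ X, L X = X * Gᴴ - Gᴴ * X := fun X => by
    have := hstar Xᴴ
    rw [conjTranspose_conjTranspose] at this
    rw [this, hL]
    simp
  -- Averaging `hL` and `hL'` replaces `G` by its skew-Hermitian part, which is still local.
  refine ⟨(2⁻¹ : ℂ) • (k - kᴴ), (2⁻¹ : ℂ) • (l - lᴴ), by simp [← smul_neg],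
    by simp [← smul_neg], fun X => ?_⟩
  have hD : ((2⁻¹ : ℂ) • (k - kᴴ)) ⊗ₖ (1 : Matrix β β ℂ) +
      (1 : Matrix α α ℂ) ⊗ₖ ((2⁻¹ : ℂ) • (l - lᴴ)) = (2⁻¹ : ℂ) • (G - Gᴴ) := by
    rw [hkl]
    simp only [conjTranspose_add, conjTranspose_kronecker, conjTranspose_one]
    ext i j
    simp only [Matrix.add_apply, Matrix.smul_apply, Matrix.sub_apply, kroneckerMap_apply,
      smul_eq_mul]
    ring
  rw [hD]
  calc L X = (2⁻¹ : ℂ) • (L X + L X) := by rw [← two_smul ℂ (L X)]; simp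
    _ = (2⁻¹ : ℂ) • ((G * X - X * G) + (X * Gᴴ - Gᴴ * X)) := by rw [← hL, ← hL']
    _ = _ := by
      simp only [smul_mul_assoc, mul_smul_comm, sub_mul, mul_sub]
      module

end Local

/-! ### Vector functionals and positive functionals -/

section States

variable {ι α β : Type*} [Fintype ι] [DecidableEq ι] [Fintype α] [Fintype β]
  [DecidableEq α] [DecidableEq β]

omit [DecidableEq ι] in
theorem vectorFunctional_conjTranspose (v : ι → ℂ) (A : Matrix ι ι ℂ) :
    vectorFunctional v Aᴴ = star (vectorFunctional v A) := by
  rw [vectorFunctional_apply, vectorFunctional_apply, ← star_dotProduct_star, star_star, star_mulVec,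
    ← dotProduct_mulVec, dotProduct_comm]

omit [DecidableEq ι] in
theorem vectorFunctional_smul (c : ℂ) (v : ι → ℂ) (A : Matrix ι ι ℂ) :
    vectorFunctional (c • v) A = (star c * c) * vectorFunctional v A := by
  simp only [vectorFunctional_apply, star_smul, mulVec_smul, dotProduct_smul, smul_dotProduct,
    smul_eq_mul]
  ring

theorem vectorFunctional_single (v : ι → ℂ) (i j : ι) :
    vectorFunctional v (Matrix.single i j 1) = star (v i) * v j := by
  rw [vectorFunctional_apply, single_mulVec, one_mul]
  exact dotProduct_single _ _ _

theorem linearFunctional_ext {f g : Matrix ι ι ℂ →ₗ[ℂ] ℂ}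
    (h : ∀ i j, f (Matrix.single i j 1) = g (Matrix.single i j 1)) : f = g := by
  refine LinearMap.ext fun A => ?_
  have hA : ∀ j k, Matrix.single j k (A j k) = A j k • Matrix.single j k (1 : ℂ) := by
    simp [smul_single]
  rw [matrix_eq_sum_single A]
  simp only [hA, map_sum, map_smul, h]

theorem eq_zero_of_vectorFunctional (N : Matrix ι ι ℂ) (h : ∀ x, vectorFunctional x N = 0) :
    N = 0 := by
  let P : (ι → ℂ) → (ι → ℂ) → ℂ := fun a b => a ⬝ᵥ N *ᵥ b
  have hP : ∀ a b, P a b = 0 := eq_zero_of_star_diagonal P (fun a b c d => by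
    simp only [P, dotProduct, mulVec, Pi.add_apply, Pi.smul_apply, smul_eq_mul]
    fun_prop) h
  ext i j
  simpa [P] using hP (Pi.single i 1) (Pi.single j 1)

/-- Polarising in both factors at once reaches all matrix entries, since basis vectors are product
vectors. -/
theorem eq_zero_of_vectorFunctional_kronVec (N : Matrix (α × β) (α × β) ℂ)
    (h : ∀ x y, vectorFunctional (kronVec x y) N = 0) : N = 0 := by
  let P : (α → ℂ) × (β → ℂ) → (α → ℂ) × (β → ℂ) → ℂ := fun a b =>
    kronVec a.1 a.2 ⬝ᵥ N *ᵥ kronVec b.1 b.2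
  have hP : ∀ a b, P a b = 0 := eq_zero_of_star_diagonal P (fun a b c d => by
    simp only [P, dotProduct, mulVec, kronVec, Prod.fst_add, Prod.snd_add, Prod.smul_fst,
      Prod.smul_snd, Pi.add_apply, Pi.smul_apply, smul_eq_mul]
    fun_prop) (fun a => by
      have := h a.1 a.2
      rwa [vectorFunctional_apply, star_kronVec] at this)
  ext i j
  have := hP (Pi.single i.1 1, Pi.single i.2 1) (Pi.single j.1 1, Pi.single j.2 1)
  simpa [P, kronVec_single] using this

theorem posSemidef_of_vectorFunctional_nonneg {N : Matrix ι ι ℂ}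
    (h : ∀ x, 0 ≤ vectorFunctional x N) : N.PosSemidef := by
  refine .of_dotProduct_mulVec_nonneg ?_ h
  refine (sub_eq_zero.1 (eq_zero_of_vectorFunctional _ fun x => ?_) : Nᴴ = N)
  rw [map_sub, vectorFunctional_conjTranspose, (IsSelfAdjoint.of_nonneg (h x)).star_eq, sub_self]

/-- Positive functionals are sums of vector functionals. -/
theorem exists_eq_sum_vectorFunctional (ω : Matrix ι ι ℂ →ₗ[ℂ] ℂ)
    (hω : ∀ A : Matrix ι ι ℂ, A.PosSemidef → 0 ≤ ω A) :
    ∃ x : ι → ι → ℂ, ω = ∑ k, vectorFunctional (x k) := by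
  -- The density matrix, `ω A = tr (ρ A)`. Factoring `ρ = C* C`, the conjugated rows of `C` are the
  -- required vectors.
  let ρ : Matrix ι ι ℂ := Matrix.of fun i j => ω (Matrix.single j i 1)
  have hρ : ρ.PosSemidef := by
    refine posSemidef_of_vectorFunctional_nonneg fun v => ?_
    have h1 : vectorFunctional v ρ = ω (vecMulVec v (star v)) := by
      rw [matrix_eq_sum_single (vecMulVec v (star v))]
      have hM : ∀ j k, Matrix.single j k (vecMulVec v (star v) j k) =
          (v j * star (v k)) • Matrix.single j k (1 : ℂ) := by
        simp [smul_single, vecMulVec_apply]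
      simp only [hM, map_sum, map_smul, vectorFunctional_apply, dotProduct, mulVec, ρ,
        Matrix.of_apply, smul_eq_mul, Finset.mul_sum, Pi.star_apply]
      rw [Finset.sum_comm]
      exact Finset.sum_congr rfl fun i _ => Finset.sum_congr rfl fun j _ => by ring
    rw [h1]
    exact hω _ (posSemidef_vecMulVec_self_star v)
  open scoped MatrixOrder in
  obtain ⟨C, hC⟩ := CStarAlgebra.nonneg_iff_eq_star_mul_self.mp hρ.nonneg
  refine ⟨fun k => star (C k), linearFunctional_ext fun j i => ?_⟩
  have : ω (Matrix.single j i 1) = ρ i j := rfl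
  rw [this, hC, LinearMap.sum_apply]
  simp only [vectorFunctional_single, Matrix.mul_apply, star_eq_conjTranspose, conjTranspose_apply,
    Pi.star_apply, star_star]
  exact Finset.sum_congr rfl fun k _ => mul_comm _ _

omit [DecidableEq α] [DecidableEq β] in
theorem kronVec_dotProduct_kronVec (x p : α → ℂ) (y q : β → ℂ) :
    kronVec x y ⬝ᵥ kronVec p q = (x ⬝ᵥ p) * (y ⬝ᵥ q) := by
  simp only [dotProduct, kronVec, Fintype.sum_prod_type, Finset.sum_mul_sum]
  exact Finset.sum_congr rfl fun a _ => Finset.sum_congr rfl fun b _ => by ring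

omit [DecidableEq α] [DecidableEq β] in
theorem kronecker_mulVec_kronVec (x : α → ℂ) (y : β → ℂ) (A : Matrix α α ℂ) (B : Matrix β β ℂ) :
    (A ⊗ₖ B) *ᵥ kronVec x y = kronVec (A *ᵥ x) (B *ᵥ y) := by
  ext i
  exact kronVec_dotProduct_kronVec (A i.1) x (B i.2) y

omit [DecidableEq α] [DecidableEq β] in
theorem vectorFunctional_kronVec_kronecker (x : α → ℂ) (y : β → ℂ) (A : Matrix α α ℂ)
    (B : Matrix β β ℂ) : vectorFunctional (kronVec x y) (A ⊗ₖ B) =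
      vectorFunctional x A * vectorFunctional y B := by
  rw [vectorFunctional_apply, kronecker_mulVec_kronVec, star_kronVec, kronVec_dotProduct_kronVec]
  rfl

theorem vectorFunctional_mem_stateSpace {v : ι → ℂ} (hv : star v ⬝ᵥ v = 1) :
    vectorFunctional v ∈ stateSpace ι :=
  ⟨by rw [vectorFunctional_apply, one_mulVec, hv], fun _ hA => hA.dotProduct_mulVec_nonneg v⟩

end States

/-! ### Separable states -/

variable {m n : ℕ}

theorem vectorFunctional_mem_separableStates {x : Fin m → ℂ} {y : Fin n → ℂ}
    (hx : star x ⬝ᵥ x = 1) (hy : star y ⬝ᵥ y = 1) :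
    vectorFunctional (kronVec x y) ∈ separableStates m n := by
  refine subset_convexHull ℝ _ ⟨vectorFunctional_mem_stateSpace ?_, _,
    vectorFunctional_mem_stateSpace hx, _, vectorFunctional_mem_stateSpace hy,
    vectorFunctional_kronVec_kronecker x y⟩
  rw [star_kronVec, kronVec_dotProduct_kronVec, hx, hy, one_mul]

theorem exists_smul_dotProduct_eq_one {ι : Type*} [Fintype ι] {x : ι → ℂ} (hx : x ≠ 0) :
    ∃ (c : ℂ) (u : ι → ℂ), star u ⬝ᵥ u = 1 ∧ x = c • u := by
  have hpos : 0 < star x ⬝ᵥ x := dotProduct_star_self_pos_iff.2 hx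
  obtain ⟨r, hr, hxr⟩ : ∃ r : ℝ, 0 < r ∧ star x ⬝ᵥ x = r := by
    obtain ⟨h1, h2⟩ := Complex.pos_iff.1 hpos
    exact ⟨_, h1, Complex.ext rfl (by simp [← h2])⟩
  have hs : (Real.sqrt r : ℂ) ≠ 0 := by
    simpa using (Real.sqrt_pos.2 hr).ne'
  refine ⟨Real.sqrt r, (Real.sqrt r : ℂ)⁻¹ • x, ?_, by rw [smul_smul, mul_inv_cancel₀ hs, one_smul]⟩
  have h2 : (Real.sqrt r : ℂ) * Real.sqrt r = r := by
    rw [← Complex.ofReal_mul, Real.mul_self_sqrt hr.le]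
  rw [star_smul, smul_dotProduct, dotProduct_smul, hxr, ← h2]
  simp only [star_inv₀, RCLike.star_def, Complex.conj_ofReal, smul_eq_mul]
  field_simp

/-- Normalising both factors carries statements about separable states over to arbitrary product
vectors. -/
theorem exists_vectorFunctional_eq_mul (x : Fin m → ℂ) (y : Fin n → ℂ) :
    vectorFunctional (kronVec x y) = 0 ∨ ∃ (c : ℂ) (ω : separableStates m n),
      vectorFunctional (kronVec x y) = c • ω.1 := by
  by_cases hx : x = 0
  · exact .inl (LinearMap.ext fun A => by simp [hx, kronVec, vectorFunctional_apply, dotProduct])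
  by_cases hy : y = 0
  · exact .inl (LinearMap.ext fun A => by simp [hy, kronVec, vectorFunctional_apply, dotProduct])
  obtain ⟨c, u, hu, rfl⟩ := exists_smul_dotProduct_eq_one hx
  obtain ⟨d, v, hv, rfl⟩ := exists_smul_dotProduct_eq_one hy
  have hcd : kronVec (c • u) (d • v) = (c * d) • kronVec u v := by
    ext i
    simp only [kronVec, Pi.smul_apply, smul_eq_mul]
    ring
  exact .inr ⟨_, ⟨_, vectorFunctional_mem_separableStates hu hv⟩, LinearMap.ext fun A => by
    rw [hcd, vectorFunctional_smul]; rfl⟩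

theorem exists_eq_sum_vectorFunctional_kronVec
    {τ : Matrix (Fin m × Fin n) (Fin m × Fin n) ℂ →ₗ[ℂ] ℂ}
    (hτ : τ ∈ productStates m n) : ∃ (x : Fin m → Fin m → ℂ) (y : Fin n → Fin n → ℂ),
      τ = ∑ i, ∑ j, vectorFunctional (kronVec (x i) (y j)) := by
  obtain ⟨-, ω, hω, σ, hσ, h⟩ := hτ
  obtain ⟨x, rfl⟩ := exists_eq_sum_vectorFunctional ω hω.2
  obtain ⟨y, rfl⟩ := exists_eq_sum_vectorFunctional σ hσ.2
  refine ⟨x, y, linearFunctional_ext fun i j => ?_⟩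
  have : Matrix.single i j (1 : ℂ) = Matrix.single i.1 j.1 1 ⊗ₖ Matrix.single i.2 j.2 1 := by
    rw [single_kronecker_single, one_mul]
  rw [this, h]
  simp only [LinearMap.sum_apply, vectorFunctional_kronVec_kronecker, Finset.sum_mul_sum]

/-- Separable states are nonnegative on block-positive matrices. -/
theorem nonneg_of_mem_separableStates {A : Matrix (Fin m × Fin n) (Fin m × Fin n) ℂ}
    (hA : ∀ x y, 0 ≤ vectorFunctional (kronVec x y) A)
    {ω : Matrix (Fin m × Fin n) (Fin m × Fin n) ℂ →ₗ[ℂ] ℂ} (hω : ω ∈ separableStates m n) :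
    0 ≤ ω A := by
  have : separableStates m n ⊆ {ω | 0 ≤ ω A} := by
    refine convexHull_min (fun τ hτ => ?_) fun τ hτ σ hσ a b ha hb _ => ?_
    · obtain ⟨x, y, rfl⟩ := exists_eq_sum_vectorFunctional_kronVec hτ
      simp only [Set.mem_ofPred_eq, LinearMap.sum_apply]
      exact Finset.sum_nonneg fun i _ => Finset.sum_nonneg fun j _ => hA _ _
    · simp only [Set.mem_ofPred_eq, LinearMap.add_apply, LinearMap.smul_apply] at *
      exact add_nonneg (smul_nonneg ha hτ) (smul_nonneg hb hσ)
  exact this hω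

theorem conjTranspose_of_mem_separableStates
    {ω : Matrix (Fin m × Fin n) (Fin m × Fin n) ℂ →ₗ[ℂ] ℂ} (hω : ω ∈ separableStates m n)
    (A : Matrix (Fin m × Fin n) (Fin m × Fin n) ℂ) : ω Aᴴ = star (ω A) := by
  have : separableStates m n ⊆ {ω | ω Aᴴ = star (ω A)} := by
    refine convexHull_min (fun τ hτ => ?_) fun τ hτ σ hσ a b ha hb _ => ?_
    · obtain ⟨x, y, rfl⟩ := exists_eq_sum_vectorFunctional_kronVec hτ
      simp only [Set.mem_ofPred_eq, LinearMap.sum_apply, vectorFunctional_conjTranspose, star_sum]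
    · simp only [Set.mem_ofPred_eq, LinearMap.add_apply, LinearMap.smul_apply] at *
      rw [hτ, hσ]
      simp
  exact this hω

theorem one_of_mem_separableStates
    {ω : Matrix (Fin m × Fin n) (Fin m × Fin n) ℂ →ₗ[ℂ] ℂ} (hω : ω ∈ separableStates m n) :
    ω 1 = 1 := by
  have : separableStates m n ⊆ {ω | ω 1 = 1} := by
    refine convexHull_min (fun τ hτ => hτ.1.1) fun τ hτ σ hσ a b ha hb hab => ?_
    simp only [Set.mem_ofPred_eq, LinearMap.add_apply, LinearMap.smul_apply] at *
    rw [hτ, hσ, ← add_smul, hab, one_smul]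
  exact this hω

theorem eq_of_separableStates {A B : Matrix (Fin m × Fin n) (Fin m × Fin n) ℂ}
    (h : ∀ ω ∈ separableStates m n, ω A = ω B) : A = B := by
  refine sub_eq_zero.1 (eq_zero_of_vectorFunctional_kronVec _ fun x y => ?_)
  obtain h0 | ⟨c, ω, hω⟩ := exists_vectorFunctional_eq_mul x y
  · rw [h0, LinearMap.zero_apply]
  · rw [hω, LinearMap.smul_apply, map_sub, h ω.1 ω.2, sub_self, smul_zero]

/-- Separable states separate matrices, so their annihilator is trivial and a dimension count
finishes. -/
theorem span_separableStates : Submodule.span ℂ (separableStates m n) = ⊤ := by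
  have h0 : (Submodule.span ℂ (separableStates m n)).dualCoannihilator = ⊥ := by
    refine (Submodule.eq_bot_iff _).2 fun A hA => eq_of_separableStates fun ω hω => ?_
    rw [map_zero]
    exact (Submodule.mem_dualCoannihilator A).1 hA ω (Submodule.subset_span hω)
  have := Subspace.finrank_add_finrank_dualCoannihilator_eq
    (Submodule.span ℂ (separableStates m n))
  rw [h0, finrank_bot, add_zero] at this
  refine Submodule.eq_top_of_finrank_eq ?_
  rw [this, ← Subspace.dual_finrank_eq]

/-! ### Differentiability of one-parameter groups -/

/-- A continuous one-parameter group in a Banach algebra is differentiable. -/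
theorem exists_hasDerivAt_of_map_add {𝔸 : Type*} [NormedRing 𝔸] [NormedAlgebra ℝ 𝔸]
    [CompleteSpace 𝔸] {f : ℝ → 𝔸} (hf : Continuous f) (h0 : f 0 = 1)
    (hadd : ∀ s t, f (s + t) = f s * f t) : ∃ a, ∀ t, HasDerivAt f (f t * a) t := by
  let J : ℝ → 𝔸 := fun h => ∫ s in (0 : ℝ)..h, f s
  have hJ : ∀ t, HasDerivAt J (f t) t := fun t =>
    intervalIntegral.integral_hasDerivAt_right (hf.intervalIntegrable _ _)
      hf.aestronglyMeasurable.stronglyMeasurableAtFilter hf.continuousAt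
  -- `J h / h` tends to `f 0 = 1` and units form an open set. Dividing `f t * J h = ∫ f` over `[t, t
  -- + h]` by `J h` then exhibits `f` as differentiable.
  obtain ⟨h, hh⟩ : ∃ h, IsUnit (J h) := by
    have h1 := hasDerivAt_iff_tendsto_slope.1 (hJ 0)
    rw [h0] at h1
    have h2 := h1.eventually (Units.isOpen.mem_nhds isUnit_one)
    obtain ⟨h, hu, hne⟩ := (h2.and self_mem_nhdsWithin).exists
    refine ⟨h, ?_⟩
    have hne' : h ≠ 0 := hne
    have hJ0 : J 0 = 0 := intervalIntegral.integral_same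
    have hu' : IsUnit (slope J 0 h) := hu
    rw [slope_def_module, hJ0, sub_zero, sub_zero] at hu'
    have := hu'.smul (Units.mk0 h hne')
    rwa [Units.smul_mk0, smul_smul, mul_inv_cancel₀ hne', one_smul] at this
  obtain ⟨u, hu⟩ := hh
  have hfJ : ∀ t, f t * J h = J (t + h) - J t := by
    intro t
    have h1 : f t * J h = ∫ s in (0 : ℝ)..h, f t * f s :=
      ((ContinuousLinearMap.mul ℝ 𝔸 (f t)).intervalIntegral_comp_comm
        (hf.intervalIntegrable 0 h)).symm
    simp only [← hadd] at h1
    rw [h1, intervalIntegral.integral_comp_add_left (fun s => f s) t, add_zero]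
    exact (intervalIntegral.integral_interval_sub_left (hf.intervalIntegrable _ _)
      (hf.intervalIntegrable _ _)).symm
  refine ⟨(f h - 1) * ↑u⁻¹, fun t => ?_⟩
  have hfe : f = fun t => (J (t + h) - J t) * ↑u⁻¹ := by
    ext t
    rw [← hfJ, ← hu, Units.mul_inv_cancel_right]
  have hd : HasDerivAt (fun t => (J (t + h) - J t) * ↑u⁻¹) ((f (t + h) - f t) * ↑u⁻¹) t :=
    (((hJ (t + h)).comp_add_const t h).sub (hJ t)).mul_const _
  rw [← hfe, hadd, ← mul_sub_one, mul_assoc] at hd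
  exact hd

/-! ### Linear extension of affine automorphisms -/

section Extension

variable {m n : ℕ}

/-- The graph of `f` is convex, so any real combination of its points collapses to `a (x, f x) - b
(y, f y)` with `a, b ≥ 0`. If the first component vanishes, `ℓ` forces `a = b`, and then `x = y`
unless `b = 0`. -/
theorem sum_smul_eq_zero_of_isAffine {E : Type*} [AddCommGroup E] [Module ℝ E] {C : Set E}
    (hC : Convex ℝ C) {f : C → C} (hf : IsAffineAutomorphism C f) (ℓ : E →ₗ[ℝ] ℝ)
    (hℓ : ∀ x ∈ C, ℓ x = 1) (s : Finset C) (c : C → ℝ) (h : ∑ x ∈ s, c x • (x : E) = 0) :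
    ∑ x ∈ s, c x • (f x : E) = 0 := by
  obtain rfl | ⟨x₀, -⟩ := s.eq_empty_or_nonempty
  · simp
  let G : Set (E × E) := Set.range fun x : C => ((x : E), (f x : E))
  have hG : Convex ℝ G := by
    rintro _ ⟨x, rfl⟩ _ ⟨y, rfl⟩ a b ha hb hab
    refine ⟨⟨_, hC x.2 y.2 ha hb hab⟩, Prod.ext rfl ?_⟩
    exact hf.2 x y _ a b ha hb hab rfl
  have key : ∀ t : Finset C, ∃ (a b : ℝ) (x y : C), 0 ≤ a ∧ 0 ≤ b ∧
      ∑ x ∈ t, c x • ((x : E), (f x : E)) =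
        a • ((x : E), (f x : E)) - b • ((y : E), (f y : E)) := by
    classical
    intro t
    induction t using Finset.induction_on with
    | empty => exact ⟨0, 0, x₀, x₀, le_rfl, le_rfl, by simp⟩
    | insert z t hz ih =>
      obtain ⟨a, b, x, y, ha, hb, hxy⟩ := ih
      rw [Finset.sum_insert hz, hxy]
      obtain hc | hc := le_total 0 (c z)
      · obtain ⟨_, ⟨w, rfl⟩, hw⟩ :=
          hG.exists_mem_add_smul_eq (Set.mem_range_self z) (Set.mem_range_self x) hc ha
        exact ⟨c z + a, b, w, y, add_nonneg hc ha, hb, by rw [hw]; abel⟩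
      · obtain ⟨_, ⟨w, rfl⟩, hw⟩ := hG.exists_mem_add_smul_eq (Set.mem_range_self z)
          (Set.mem_range_self y) (neg_nonneg.2 hc) hb
        exact ⟨a, -c z + b, x, w, ha, add_nonneg (neg_nonneg.2 hc) hb, by rw [hw]; module⟩
  obtain ⟨a, b, x, y, ha, hb, hxy⟩ := key s
  have h1 := congrArg Prod.fst hxy
  have h2 := congrArg Prod.snd hxy
  simp only [Prod.fst_sum, Prod.snd_sum, Prod.smul_mk, Prod.fst_sub, Prod.snd_sub] at h1 h2
  rw [h] at h1
  have hab : a = b := by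
    have := congrArg ℓ h1
    rw [map_zero, map_sub, map_smul, map_smul, hℓ x x.2, hℓ y y.2] at this
    simpa [sub_eq_zero] using this.symm
  rw [h2, hab]
  by_cases hb0 : b = 0
  · simp [hb0]
  · rw [hab, ← smul_sub, eq_comm, smul_eq_zero_iff_right hb0, sub_eq_zero] at h1
    rw [Subtype.ext h1, sub_self]

/-- Every complex relation among separable states must persist among their images. States are
Hermitian, so the real and imaginary parts of the coefficients give relations separately, and the
real case applies. -/
theorem exists_linear_extension {f : separableStates m n → separableStates m n}
    (hf : IsAffineAutomorphism (separableStates m n) f) :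
    ∃ T : (Matrix (Fin m × Fin n) (Fin m × Fin n) ℂ →ₗ[ℂ] ℂ) →ₗ[ℂ]
      (Matrix (Fin m × Fin n) (Fin m × Fin n) ℂ →ₗ[ℂ] ℂ), ∀ ω : separableStates m n,
        T ω = f ω := by
  let g := Finsupp.linearCombination ℂ (fun ω : separableStates m n => ω.1)
  let h := Finsupp.linearCombination ℂ (fun ω : separableStates m n => (f ω).1)
  have hg : LinearMap.range g = ⊤ := by
    rw [Finsupp.range_linearCombination, Subtype.range_coe, span_separableStates]
  let ℓ : (Matrix (Fin m × Fin n) (Fin m × Fin n) ℂ →ₗ[ℂ] ℂ) →ₗ[ℝ] ℝ :=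
    { toFun := fun ω => (ω 1).re
      map_add' := fun _ _ => rfl
      map_smul' := fun c ω => by simp }
  have hℓ : ∀ ω ∈ separableStates m n, ℓ ω = 1 := fun ω hω => by
    simp [ℓ, one_of_mem_separableStates hω]
  have hker : ∀ c, g c = 0 → h c = 0 := by
    intro c hc
    simp only [g, h, Finsupp.linearCombination_apply, Finsupp.sum] at hc ⊢
    -- Evaluating the relation at `Aᴴ` and conjugating conjugates the coefficients.
    have hc' : ∑ ω ∈ c.support, star (c ω) • ω.1 = 0 := by
      refine LinearMap.ext fun A => ?_
      have := congrArg star (LinearMap.congr_fun hc Aᴴ)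
      simpa [LinearMap.sum_apply, conjTranspose_of_mem_separableStates] using this
    have hre' : ∑ ω ∈ c.support, (c ω).re • ω.1 = 0 := by
      refine LinearMap.ext fun A => ?_
      have h1 := LinearMap.congr_fun hc A
      have h2 := LinearMap.congr_fun hc' A
      simp only [LinearMap.sum_apply, LinearMap.smul_apply, smul_eq_mul, LinearMap.zero_apply,
        Complex.real_smul, Complex.re_eq_add_conj] at h1 h2 ⊢
      calc _ = (∑ ω ∈ c.support, c ω * ω.1 A + ∑ ω ∈ c.support, star (c ω) * ω.1 A) / 2 := by
            rw [← Finset.sum_add_distrib, Finset.sum_div]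
            exact Finset.sum_congr rfl fun ω _ => by rw [RCLike.star_def]; ring
        _ = 0 := by rw [h1, h2]; simp
    have hre : ∑ ω ∈ c.support, (c ω).re • (f ω).1 = 0 :=
      sum_smul_eq_zero_of_isAffine (convex_convexHull ℝ _) hf ℓ hℓ c.support
        (fun ω => (c ω).re) hre'
    have him' : ∑ ω ∈ c.support, (c ω).im • ω.1 = 0 := by
      refine LinearMap.ext fun A => ?_
      have h1 := LinearMap.congr_fun hc A
      have h2 := LinearMap.congr_fun hc' A
      simp only [LinearMap.sum_apply, LinearMap.smul_apply, smul_eq_mul, LinearMap.zero_apply,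
        Complex.real_smul, Complex.im_eq_sub_conj] at h1 h2 ⊢
      calc _ = (∑ ω ∈ c.support, c ω * ω.1 A - ∑ ω ∈ c.support, star (c ω) * ω.1 A) /
            (2 * Complex.I) := by
            rw [← Finset.sum_sub_distrib, Finset.sum_div]
            exact Finset.sum_congr rfl fun ω _ => by rw [RCLike.star_def]; ring
        _ = 0 := by rw [h1, h2]; simp
    have him : ∑ ω ∈ c.support, (c ω).im • (f ω).1 = 0 :=
      sum_smul_eq_zero_of_isAffine (convex_convexHull ℝ _) hf ℓ hℓ c.support
        (fun ω => (c ω).im) him'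
    calc _ = ∑ ω ∈ c.support, (c ω).re • (f ω).1 +
          Complex.I • ∑ ω ∈ c.support, (c ω).im • (f ω).1 := by
          rw [Finset.smul_sum, ← Finset.sum_add_distrib]
          refine Finset.sum_congr rfl fun ω _ => LinearMap.ext fun A => ?_
          simp only [LinearMap.add_apply, LinearMap.smul_apply, Complex.real_smul, smul_eq_mul]
          conv_lhs => rw [← Complex.re_add_im (c ω)]
          ring
      _ = 0 := by rw [hre, him]; simp
  obtain ⟨k, hk⟩ := LinearMap.exists_rightInverse_of_surjective g hg
  refine ⟨h ∘ₗ k, fun ω => ?_⟩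
  have h1 : g (k ω - Finsupp.single ω 1) = 0 := by
    rw [map_sub, ← LinearMap.comp_apply, hk]
    simp [g]
  have h2 := hker _ h1
  rw [map_sub, sub_eq_zero] at h2
  rw [LinearMap.comp_apply, h2]
  simp [h]

/-- The action of an affine automorphism of the separable states on the observables. -/
theorem exists_dual_action {f : separableStates m n → separableStates m n}
    (hf : IsAffineAutomorphism (separableStates m n) f) :
    ∃ T : Matrix (Fin m × Fin n) (Fin m × Fin n) ℂ →ₗ[ℂ] Matrix (Fin m × Fin n) (Fin m × Fin n) ℂ,
      ∀ (ω : separableStates m n) A, (f ω).1 A = ω.1 (T A) := by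
  obtain ⟨T, hT⟩ := exists_linear_extension hf
  let e := Module.evalEquiv ℂ (Matrix (Fin m × Fin n) (Fin m × Fin n) ℂ)
  refine ⟨e.symm.toLinearMap ∘ₗ T.dualMap ∘ₗ e.toLinearMap, fun ω A => ?_⟩
  rw [← hT]
  exact (Module.apply_evalEquiv_symm_apply _ _ ω.1 (T.dualMap (e A))).symm

end Extension

/-! ### Generators and their exponentials -/

section Banach

/-- A weakly continuous one-parameter group of linear maps on a finite-dimensional space has a
generator. -/
theorem exists_generator_of_continuous {E : Type*} [NormedAddCommGroup E] [NormedSpace ℂ E]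
    [FiniteDimensional ℂ E] {T : ℝ → E →ₗ[ℂ] E} (h0 : T 0 = LinearMap.id)
    (hadd : ∀ s t, T (s + t) = T s ∘ₗ T t)
    (hc : ∀ A (φ : E →ₗ[ℂ] ℂ), Continuous fun t => φ (T t A)) :
    ∃ L : E →ₗ[ℂ] E, ∀ A (φ : E →ₗ[ℂ] ℂ), HasDerivAt (fun t => φ (T t A)) (φ (L A)) 0 := by
  have : CompleteSpace E := FiniteDimensional.complete ℂ E
  let F : ℝ → E →L[ℂ] E := fun t => LinearMap.toContinuousLinearMap (T t)
  have hF : Continuous F := by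
    refine continuous_clm_apply.2 fun A => ?_
    let e := (Module.finBasis ℂ E).equivFunL
    have h1 : Continuous fun t => e (T t A) :=
      continuous_pi fun i => hc A ((Module.finBasis ℂ E).coord i)
    have h2 := e.symm.continuous.comp h1
    simpa [F, Function.comp_def] using h2
  have hF0 : F 0 = 1 := by
    ext A
    simp [F, h0]
  have hFadd : ∀ s t, F (s + t) = F s * F t := by
    intro s t
    ext A
    simp [F, hadd]
  obtain ⟨L, hL⟩ := exists_hasDerivAt_of_map_add hF hF0 hFadd
  refine ⟨L.toLinearMap, fun A φ => ?_⟩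
  have h1 := hL 0
  rw [hF0, one_mul] at h1
  let ev : (E →L[ℂ] E) →L[ℂ] ℂ :=
    (LinearMap.toContinuousLinearMap φ).comp (ContinuousLinearMap.apply ℂ E A)
  exact (ev.restrictScalars ℝ).hasFDerivAt.comp_hasDerivAt (0 : ℝ) h1

/-- A group whose generator is the commutator with `D` is implemented by `exp (t D)`. -/
theorem eq_conjugation_of_generator {𝔸 : Type*} [NormedRing 𝔸] [NormedAlgebra ℂ 𝔸]
    [FiniteDimensional ℂ 𝔸] {T : ℝ → 𝔸 →ₗ[ℂ] 𝔸} {L : 𝔸 →ₗ[ℂ] 𝔸} (h0 : T 0 = LinearMap.id)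
    (hadd : ∀ s t, T (s + t) = T s ∘ₗ T t)
    (hT : ∀ A (φ : 𝔸 →ₗ[ℂ] ℂ), HasDerivAt (fun t => φ (T t A)) (φ (L A)) 0) {D : 𝔸}
    (hL : ∀ X, L X = D * X - X * D) (t : ℝ) (A : 𝔸) :
    T t A = NormedSpace.exp (t • D) * A * NormedSpace.exp (-(t • D)) := by
  have : CompleteSpace 𝔸 := FiniteDimensional.complete ℂ 𝔸
  let _ : NormedAlgebra ℚ 𝔸 := .restrictScalars ℚ ℂ 𝔸
  have hT0 : ∀ A, HasDerivAt (fun t => T t A) (L A) 0 := by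
    intro A
    let e := (Module.finBasis ℂ 𝔸).equivFunL
    have h1 : HasDerivAt (fun t => e (T t A)) (e (L A)) 0 :=
      hasDerivAt_pi.2 fun i => hT A ((Module.finBasis ℂ 𝔸).coord i)
    have h2 := (e.symm.toContinuousLinearMap.restrictScalars ℝ).hasFDerivAt.comp_hasDerivAt
      (0 : ℝ) h1
    simpa [Function.comp_def] using h2
  have hT' : ∀ t, HasDerivAt (fun t => T t A) (L (T t A)) t := by
    intro t
    have h1 : HasDerivAt (fun s => T s (T t A)) (L (T t A)) (t - t) := by
      rw [sub_self]; exact hT0 (T t A)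
    have h2 := h1.comp_sub_const t t
    have h3 : ∀ s, T s (T t A) = T (s + t) A := fun s => by rw [hadd, LinearMap.comp_apply]
    simpa only [h3, sub_add_cancel] using h2
  -- Undoing the expected flow gives a curve with zero derivative.
  let g : ℝ → 𝔸 := fun t =>
    NormedSpace.exp (t • (-D)) * T t A * NormedSpace.exp (t • D)
  have hg : ∀ t, HasDerivAt g 0 t := by
    intro t
    have h1 := ((hasDerivAt_exp_smul_const (-D) t).mul (hT' t)).mul
      (hasDerivAt_exp_smul_const' D t)
    refine h1.congr_deriv ?_
    rw [hL]
    simp only [Pi.mul_apply]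
    noncomm_ring
  have hconst : g t = g 0 := is_const_of_deriv_eq_zero (fun t => (hg t).differentiableAt)
    (fun t => (hg t).deriv) t 0
  have h1 : NormedSpace.exp (t • D) * NormedSpace.exp (-(t • D)) = 1 := by
    rw [← NormedSpace.exp_add_of_commute (Commute.refl _).neg_right, add_neg_cancel,
      NormedSpace.exp_zero]
  simp only [g, h0, smul_neg, zero_smul, neg_zero, NormedSpace.exp_zero, one_mul, mul_one,
    LinearMap.id_apply] at hconst
  calc T t A = (NormedSpace.exp (t • D) * NormedSpace.exp (-(t • D))) * T t A *
        (NormedSpace.exp (t • D) * NormedSpace.exp (-(t • D))) := by rw [h1, one_mul, mul_one]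
    _ = NormedSpace.exp (t • D) * (NormedSpace.exp (-(t • D)) * T t A * NormedSpace.exp (t • D)) *
        NormedSpace.exp (-(t • D)) := by noncomm_ring
    _ = _ := by rw [hconst]

end Banach

/-! ### The generator of the dual group -/

section Generator

variable {m n : ℕ}

theorem continuous_of_separableStates {T : ℝ → Matrix (Fin m × Fin n) (Fin m × Fin n) ℂ}
    (h : ∀ ω ∈ separableStates m n, Continuous fun t => ω (T t))
    (ω : Matrix (Fin m × Fin n) (Fin m × Fin n) ℂ →ₗ[ℂ] ℂ) : Continuous fun t => ω (T t) := by
  have hω : ω ∈ Submodule.span ℂ (separableStates m n) := by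
    rw [span_separableStates]; trivial
  induction hω using Submodule.span_induction with
  | mem ω hω => exact h ω hω
  | zero => simpa using continuous_const
  | add ω σ _ _ hω hσ => exact hω.add hσ
  | smul c ω _ hω => exact hω.const_smul c

attribute [local instance] Matrix.linftyOpNormedAddCommGroup Matrix.linftyOpNormedSpace in
theorem exists_generator
    {Φ : ℝ → separableStates m n → separableStates m n}
    (hΦ : IsOneParameterAffineGroup (separableStates m n) Φ) :
    ∃ (T : ℝ → Matrix (Fin m × Fin n) (Fin m × Fin n) ℂ →ₗ[ℂ]
        Matrix (Fin m × Fin n) (Fin m × Fin n) ℂ)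
      (L : Matrix (Fin m × Fin n) (Fin m × Fin n) ℂ →ₗ[ℂ]
        Matrix (Fin m × Fin n) (Fin m × Fin n) ℂ),
      (∀ t (ω : separableStates m n) A, (Φ t ω).1 A = ω.1 (T t A)) ∧ T 0 = LinearMap.id ∧
      (∀ s t, T (s + t) = T s ∘ₗ T t) ∧
      ∀ A (φ : Matrix (Fin m × Fin n) (Fin m × Fin n) ℂ →ₗ[ℂ] ℂ),
        HasDerivAt (fun t => φ (T t A)) (φ (L A)) 0 := by
  choose T hT using fun t => exists_dual_action (hΦ.affine t)
  have h0 : T 0 = LinearMap.id := by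
    refine LinearMap.ext fun A => eq_of_separableStates fun ω hω => ?_
    have := hT 0 ⟨ω, hω⟩ A
    rw [hΦ.map_zero] at this
    exact this.symm
  have hadd : ∀ s t, T (s + t) = T s ∘ₗ T t := by
    intro s t
    refine LinearMap.ext fun A => eq_of_separableStates fun ω hω => ?_
    have h1 := hT (s + t) ⟨ω, hω⟩ A
    -- Dualising reverses composition; this is harmless because `ℝ` is commutative.
    rw [add_comm, hΦ.map_add, hT, hT, add_comm] at h1
    exact h1.symm
  obtain ⟨L, hL⟩ := exists_generator_of_continuous h0 hadd fun A φ =>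
    continuous_of_separableStates (fun ω hω => by
      have := hΦ.continuous ⟨ω, hω⟩ A
      simp only [hT] at this
      exact this) φ
  exact ⟨T, L, hT, h0, hadd, hL⟩

/-- Nonnegativity holds for times of both signs, so `t = 0` is an interior minimum and the
derivative vanishes, rather than being merely nonnegative. -/
theorem vectorFunctional_generator_eq_zero
    {Φ : ℝ → separableStates m n → separableStates m n}
    {T : ℝ → Matrix (Fin m × Fin n) (Fin m × Fin n) ℂ →ₗ[ℂ]
        Matrix (Fin m × Fin n) (Fin m × Fin n) ℂ}
    {L : Matrix (Fin m × Fin n) (Fin m × Fin n) ℂ →ₗ[ℂ]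
        Matrix (Fin m × Fin n) (Fin m × Fin n) ℂ}
    (hT : ∀ t (ω : separableStates m n) A, (Φ t ω).1 A = ω.1 (T t A)) (h0 : T 0 = LinearMap.id)
    (hL : ∀ A (ω : Matrix (Fin m × Fin n) (Fin m × Fin n) ℂ →ₗ[ℂ] ℂ),
      HasDerivAt (fun t => ω (T t A)) (ω (L A)) 0)
    {A : Matrix (Fin m × Fin n) (Fin m × Fin n) ℂ}
    (hA : ∀ x y, 0 ≤ vectorFunctional (kronVec x y) A) {x : Fin m → ℂ} {y : Fin n → ℂ}
    (hxy : vectorFunctional (kronVec x y) A = 0) : vectorFunctional (kronVec x y) (L A) = 0 := by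
  obtain h | ⟨c, ω, h⟩ := exists_vectorFunctional_eq_mul x y
  · rw [h, LinearMap.zero_apply]
  rw [h, LinearMap.smul_apply, smul_eq_mul, mul_eq_zero] at hxy ⊢
  refine hxy.imp id fun hω => ?_
  have hpos : ∀ t, 0 ≤ ω.1 (T t A) := fun t => by
    rw [← hT]
    exact nonneg_of_mem_separableStates hA (Φ t ω).2
  have hre := Complex.reCLM.hasFDerivAt.comp_hasDerivAt (0 : ℝ) (hL A ω.1)
  have him := Complex.imCLM.hasFDerivAt.comp_hasDerivAt (0 : ℝ) (hL A ω.1)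
  refine Complex.ext ?_ ?_
  · refine IsLocalMin.hasDerivAt_eq_zero (Filter.Eventually.of_forall fun t => ?_) hre
    have h1 : ω.1 (T 0 A) = 0 := by rw [h0]; exact hω
    simpa [h1] using (Complex.nonneg_iff.1 (hpos t)).1
  · have : (Complex.imCLM ∘ fun t => ω.1 (T t A)) = fun _ => 0 := by
      ext t
      exact (Complex.nonneg_iff.1 (hpos t)).2.symm
    rw [this] at him
    exact him.unique (hasDerivAt_const _ _)

theorem exists_local_generator (o : Fin m × Fin n)
    {Φ : ℝ → separableStates m n → separableStates m n}
    {T : ℝ → Matrix (Fin m × Fin n) (Fin m × Fin n) ℂ →ₗ[ℂ]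
        Matrix (Fin m × Fin n) (Fin m × Fin n) ℂ}
    {L : Matrix (Fin m × Fin n) (Fin m × Fin n) ℂ →ₗ[ℂ]
        Matrix (Fin m × Fin n) (Fin m × Fin n) ℂ}
    (hT : ∀ t (ω : separableStates m n) A, (Φ t ω).1 A = ω.1 (T t A)) (h0 : T 0 = LinearMap.id)
    (hL : ∀ A (ω : Matrix (Fin m × Fin n) (Fin m × Fin n) ℂ →ₗ[ℂ] ℂ),
      HasDerivAt (fun t => ω (T t A)) (ω (L A)) 0) :
    ∃ (a : Matrix (Fin m) (Fin m) ℂ) (b : Matrix (Fin n) (Fin n) ℂ), aᴴ = -a ∧ bᴴ = -b ∧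
      ∀ X, L X = (a ⊗ₖ 1 + 1 ⊗ₖ b) * X - X * (a ⊗ₖ 1 + 1 ⊗ₖ b) := by
  have hvec : ∀ k ψ : Fin m × Fin n → ℂ, star k ⬝ᵥ ψ = 0 →
      vectorFunctional k (vecMulVec ψ (star ψ)) = 0 := by
    intro k ψ h
    rw [vectorFunctional_apply, vecMulVec_mulVec, dotProduct_smul, h, smul_zero]
  have hpos : ∀ k ψ : Fin m × Fin n → ℂ, 0 ≤ vectorFunctional k (vecMulVec ψ (star ψ)) :=
    fun k ψ => (posSemidef_vecMulVec_self_star ψ).dotProduct_mulVec_nonneg k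
  refine exists_eq_local_commutator L (fun x y ψ h => ?_) (fun x y ψ h => ?_) ?_ ?_ o
  · exact vectorFunctional_generator_eq_zero hT h0 hL (fun x y => hpos _ ψ) (hvec _ _ h)
  · refine vectorFunctional_generator_eq_zero hT h0 hL (fun x y => ?_) ?_
    · rw [vectorFunctional_partialTranspose]
      exact hpos _ ψ
    · rw [vectorFunctional_partialTranspose]
      exact hvec _ _ h
  · refine eq_of_separableStates fun ω hω => ?_
    have h1 : (fun t => ω (T t 1)) = fun _ => 1 := by
      ext t
      rw [← hT t ⟨ω, hω⟩, one_of_mem_separableStates (Φ t ⟨ω, hω⟩).2]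
    have := hL 1 ω
    rw [h1] at this
    rw [map_zero]
    exact this.unique (hasDerivAt_const _ _)
  · intro X
    refine eq_of_separableStates fun ω hω => ?_
    have h1 : (fun t => ω (T t Xᴴ)) = fun t => star (ω (T t X)) := by
      ext t
      rw [← hT t ⟨ω, hω⟩, ← hT t ⟨ω, hω⟩, conjTranspose_of_mem_separableStates (Φ t ⟨ω, hω⟩).2]
    have := hL Xᴴ ω
    rw [h1] at this
    rw [conjTranspose_of_mem_separableStates hω]
    exact this.unique (hL X ω).star

end Generator

/-! ### Exponentials of local skew-Hermitian matrices -/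

section Unitary

attribute [local instance] Matrix.linftyOpNormedRing Matrix.linftyOpNormedAlgebra

variable {ι α β : Type*} [Fintype ι] [DecidableEq ι] [Fintype α] [Fintype β]
  [DecidableEq α] [DecidableEq β]

theorem exp_smul_mem_unitaryGroup {a : Matrix ι ι ℂ} (ha : aᴴ = -a) (t : ℝ) :
    NormedSpace.exp (t • a) ∈ unitaryGroup ι ℂ := by
  rw [mem_unitaryGroup_iff', star_eq_conjTranspose, ← exp_conjTranspose, conjTranspose_smul, ha,
    star_trivial, smul_neg, exp_neg, nonsing_inv_mul]
  exact (isUnit_iff_isUnit_det _).1 (isUnit_exp _)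

theorem isOneParameterUnitaryGroup_exp {a : Matrix ι ι ℂ} (ha : aᴴ = -a) :
    IsOneParameterUnitaryGroup fun t : ℝ =>
      (⟨NormedSpace.exp (t • a), exp_smul_mem_unitaryGroup ha t⟩ : unitaryGroup ι ℂ) where
  map_zero := Subtype.ext (by simp)
  map_add s t := Subtype.ext (by
    rw [Submonoid.coe_mul]
    simp only [add_smul]
    exact exp_add_of_commute _ _ ((Commute.refl a).smul_left s |>.smul_right t))
  continuous := by
    refine Continuous.subtype_mk ?_ _
    exact NormedSpace.exp_continuous.comp (continuous_id.smul continuous_const)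

/-- `A ↦ A ⊗ 1` and `B ↦ 1 ⊗ B` are continuous ring homomorphisms with commuting ranges, so both
commute with `exp`. -/
theorem exp_kronecker_exp (a : Matrix α α ℂ) (b : Matrix β β ℂ) :
    NormedSpace.exp a ⊗ₖ NormedSpace.exp b =
      NormedSpace.exp (a ⊗ₖ (1 : Matrix β β ℂ) + (1 : Matrix α α ℂ) ⊗ₖ b) := by
  let l : Matrix α α ℂ →+* Matrix (α × β) (α × β) ℂ :=
    { toFun := fun A => A ⊗ₖ 1
      map_one' := one_kronecker_one
      map_mul' := fun A B => by rw [← mul_kronecker_mul, one_mul]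
      map_zero' := zero_kronecker _
      map_add' := fun A B => add_kronecker _ _ _ }
  let r : Matrix β β ℂ →+* Matrix (α × β) (α × β) ℂ :=
    { toFun := fun B => 1 ⊗ₖ B
      map_one' := one_kronecker_one
      map_mul' := fun A B => by rw [← mul_kronecker_mul, one_mul]
      map_zero' := kronecker_zero _
      map_add' := fun A B => kronecker_add _ _ _ }
  have hl : Continuous l := continuous_matrix fun i j =>
    (continuous_id.matrix_elem i.1 j.1).mul continuous_const
  have hr : Continuous r := continuous_matrix fun i j =>
    continuous_const.mul (continuous_id.matrix_elem i.2 j.2)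
  have h1 : l (NormedSpace.exp a) = NormedSpace.exp (l a) := NormedSpace.map_exp l hl a
  have h2 : r (NormedSpace.exp b) = NormedSpace.exp (r b) := NormedSpace.map_exp r hr b
  have hcomm : Commute (l a) (r b) := by
    change a ⊗ₖ 1 * 1 ⊗ₖ b = 1 ⊗ₖ b * a ⊗ₖ 1
    simp [← mul_kronecker_mul]
  rw [show a ⊗ₖ (1 : Matrix β β ℂ) + (1 : Matrix α α ℂ) ⊗ₖ b = l a + r b from rfl,
    exp_add_of_commute _ _ hcomm, ← h1, ← h2]
  change _ = _ ⊗ₖ 1 * 1 ⊗ₖ _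
  rw [← mul_kronecker_mul, mul_one, one_mul]

end Unitary

open scoped Matrix.Norms.Operator in
theorem matrix_eq_conjugation_of_generator {ι : Type*} [Fintype ι] [DecidableEq ι]
    {T : ℝ → Matrix ι ι ℂ →ₗ[ℂ] Matrix ι ι ℂ} {L : Matrix ι ι ℂ →ₗ[ℂ] Matrix ι ι ℂ}
    (h0 : T 0 = LinearMap.id) (hadd : ∀ s t, T (s + t) = T s ∘ₗ T t)
    (hT : ∀ A (φ : Matrix ι ι ℂ →ₗ[ℂ] ℂ), HasDerivAt (fun t => φ (T t A)) (φ (L A)) 0)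
    {D : Matrix ι ι ℂ} (hL : ∀ X, L X = D * X - X * D) (t : ℝ) (A : Matrix ι ι ℂ) :
    T t A = NormedSpace.exp (t • D) * A * NormedSpace.exp (-(t • D)) :=
  eq_conjugation_of_generator h0 hadd hT hL t A

end SeparableStates

/-! ### The main theorem -/

theorem corollary5p8 (m n : ℕ)
    (Φ : ℝ → SeparableStates.separableStates m n → SeparableStates.separableStates m n)
    (hΦ : SeparableStates.IsOneParameterAffineGroup (SeparableStates.separableStates m n) Φ) :
    ∃ (U : ℝ → Matrix.unitaryGroup (Fin m) ℂ) (V : ℝ → Matrix.unitaryGroup (Fin n) ℂ),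
      SeparableStates.IsOneParameterUnitaryGroup U ∧
      SeparableStates.IsOneParameterUnitaryGroup V ∧
      ∀ (t : ℝ) (ω : SeparableStates.separableStates m n)
        (A : Matrix (Fin m × Fin n) (Fin m × Fin n) ℂ),
        (Φ t ω : Matrix (Fin m × Fin n) (Fin m × Fin n) ℂ →ₗ[ℂ] ℂ) A =
          (ω : Matrix (Fin m × Fin n) (Fin m × Fin n) ℂ →ₗ[ℂ] ℂ)
            (((U t : Matrix (Fin m) (Fin m) ℂ) ⊗ₖ (V t : Matrix (Fin n) (Fin n) ℂ)) * A *
              ((U t : Matrix (Fin m) (Fin m) ℂ) ⊗ₖ (V t : Matrix (Fin n) (Fin n) ℂ))ᴴ) := by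
  -- The generator argument reads off entries at a base index `o`. If there is none, `1 = 0`, no
  -- separable state exists and trivial groups suffice.
  by_cases hmn : Nonempty (Fin m × Fin n)
  · obtain ⟨o⟩ := hmn
    obtain ⟨T, L, hT, h0, hadd, hL⟩ := SeparableStates.exists_generator hΦ
    obtain ⟨a, b, ha, hb, hab⟩ := SeparableStates.exists_local_generator o hT h0 hL
    refine ⟨_, _, SeparableStates.isOneParameterUnitaryGroup_exp ha,
      SeparableStates.isOneParameterUnitaryGroup_exp hb, fun t ω A => ?_⟩
    have hD : (NormedSpace.exp (t • a)) ⊗ₖ (NormedSpace.exp (t • b)) =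
        NormedSpace.exp (t • (a ⊗ₖ (1 : Matrix (Fin n) (Fin n) ℂ) +
          (1 : Matrix (Fin m) (Fin m) ℂ) ⊗ₖ b)) := by
      rw [SeparableStates.exp_kronecker_exp, smul_add, Matrix.smul_kronecker,
        Matrix.kronecker_smul]
    have hstar : (a ⊗ₖ (1 : Matrix (Fin n) (Fin n) ℂ) + (1 : Matrix (Fin m) (Fin m) ℂ) ⊗ₖ b)ᴴ =
        -(a ⊗ₖ (1 : Matrix (Fin n) (Fin n) ℂ) + (1 : Matrix (Fin m) (Fin m) ℂ) ⊗ₖ b) := by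
      ext i j
      simp only [Matrix.conjTranspose_add, Matrix.conjTranspose_kronecker, ha, hb,
        Matrix.conjTranspose_one, Matrix.add_apply, Matrix.neg_apply, Matrix.kroneckerMap_apply]
      ring
    rw [hT]
    simp only [hD]
    rw [← Matrix.exp_conjTranspose, Matrix.conjTranspose_smul, hstar, star_trivial, smul_neg,
      SeparableStates.matrix_eq_conjugation_of_generator h0 hadd hL hab t A]
  · have hS : ∀ ω : SeparableStates.separableStates m n, False := fun ω => by
      have h1 := SeparableStates.one_of_mem_separableStates ω.2
      have : IsEmpty (Fin m × Fin n) := not_nonempty_iff.1 hmn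
      rw [Subsingleton.elim (1 : Matrix (Fin m × Fin n) (Fin m × Fin n) ℂ) 0, map_zero] at h1
      exact zero_ne_one h1
    exact ⟨fun _ => 1, fun _ => 1, ⟨rfl, fun _ _ => (one_mul 1).symm, continuous_const⟩,
      ⟨rfl, fun _ _ => (one_mul 1).symm, continuous_const⟩, fun _ ω => (hS ω).elim⟩
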